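/- Let $K$ be a finite field of characteristic $p$ and order $q$, and let $\psi_K(x)=\exp\bigl(2\pi i\,\mathrm{Tr}_{K/\mathbb F_p}(x)/p\bigr)$ be its canonical additive character. Let $d$ be a non-negative integer with $\gcd(d,q-1)=1$, and for $a\in K$ put $$W_{K,d}(a)=\sum_{x\in K}\psi_K(x^d+ax).$$ Let $s$ be the $2$-adic valuation of $[K:\mathbb F_p]$. If $W_{K,d}$ is symmetric three-valued with values $0,\pm A$, that is, if the set $\{W_{K,d}(a):a\in K^\times\}$ has exactly three elements and equals $\{0,A,-A\}$ for some $A \in \mathbb C$, then $$|A|\ \ge\ p^{2^{s-1}}\sqrt q .$$ (When $s=0$ the factor $p^{2^{s-1}}$ is $p^{1/2}$.) -/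

import Mathlib

/-- The canonical additive character `x ↦ exp (2πi Tr(x) / p)` of a finite field `K` of
characteristic `p`, where `Tr` is the absolute trace `K → 𝔽_p`. -/
noncomputable def canonicalChar (p : ℕ) [Fact p.Prime] (K : Type*) [Field K]
    [Algebra (ZMod p) K] : AddChar K ℂ :=
  (ZMod.stdAddChar (N := p)).compAddMonoidHom (Algebra.trace (ZMod p) K).toAddMonoidHom

/-- The character is given by the usual exponential formula. -/
theorem canonicalChar_eq_exp (p : ℕ) [Fact p.Prime] (K : Type*) [Field K]
    [Algebra (ZMod p) K] (x : K) :
    canonicalChar p K x =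
      Complex.exp (2 * Real.pi * Complex.I * ((Algebra.trace (ZMod p) K x).val : ℂ) / p) := by
  have h := ZMod.stdAddChar_coe (N := p) ((Algebra.trace (ZMod p) K x).val : ℤ)
  rw [Int.cast_natCast, ZMod.natCast_zmod_val] at h
  simpa [canonicalChar] using h

/-- The Weil sum `W_{K,d}(a) = ∑_{x ∈ K} ψ_K (x ^ d + a x)`. -/
noncomputable def weilSum (p : ℕ) [Fact p.Prime] (K : Type*) [Field K] [Fintype K]
    [Algebra (ZMod p) K] (d : ℕ) (a : K) : ℂ :=
  ∑ x : K, canonicalChar p K (x ^ d + a * x)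

/-- The value set `{W_{K,d}(a) : a ∈ Kˣ}`. -/
def weilValueSet (p : ℕ) [Fact p.Prime] (K : Type*) [Field K] [Fintype K]
    [Algebra (ZMod p) K] (d : ℕ) : Set ℂ :=
  Set.range fun a : Kˣ => weilSum p K d (a : K)

/-- `W_{K,d}` is three-valued: its value set has cardinality three. -/
def IsThreeValued (p : ℕ) [Fact p.Prime] (K : Type*) [Field K] [Fintype K]
    [Algebra (ZMod p) K] (d : ℕ) : Prop :=
  (weilValueSet p K d).ncard = 3

/-!
Call `d` degenerate on a field if `x ↦ x ^ d` is additive. Let `W` be a Weil sum taking only the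
values `0` and `±A`. The first moment `∑ W = q` makes `A` an integer dividing `q`, hence `±p ^ k`,
and the second moment gives `p ^ k > √q`. The third moment gives `A ^ 2 = q N` with `N` the number
of solutions of `(u + 1) ^ d = u ^ d + 1`, so `|F| q ≤ A ^ 2` as soon as `d` is degenerate on a
subfield `F`. It remains to climb the tower of subfields of degree `2 ^ t` over `𝔽_p`.

On `𝔽_p` degeneracy follows from the rationality of `W` by Galois conjugation. For a quadratic step
`L ⊂ F`, the Hasse–Davenport relation for lifted Gauss sums transfers the divisibility of the sums
over `K` by `p ^ k` to the sums over `F`, which therefore never equal `-|L|`. If `d` is degenerate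
on `L`, this says that every `L`-linear form on `F` agrees with `x ↦ Tr (x ^ d) ^ (1 / d)` at some
nonzero point, and a function homogeneous over `L` with this property is additive. Nondegeneracy of
the trace form then makes `d` degenerate on `F`.
-/

section MonicPolynomials

open Polynomial UniqueFactorizationMonoid

open Finset.HasAntidiagonal (antidiagonal mem_antidiagonal)

variable {F : Type*} [Field F]

lemma finite_setOf_monic_natDegree_eq [Finite F] (n : ℕ) :
    {f : F[X] | f.Monic ∧ f.natDegree = n}.Finite := by
  have : Finite (degreeLT F (n + 1)) := .of_equiv _ (degreeLTEquiv F (n + 1)).toEquiv.symm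
  refine (Set.toFinite (degreeLT F (n + 1) : Set F[X])).subset fun f ⟨_, hf⟩ ↦ ?_
  exact mem_degreeLT.2 (degree_le_natDegree.trans_lt (by exact_mod_cast hf.trans_lt n.lt_succ_self))

open Classical in
/-- The von Mangoldt function of `F[X]`: the degree of `P` at a power of an irreducible polynomial
`P`, and `0` elsewhere. On such a power, `P` is recovered, up to a unit, as the radical. -/
noncomputable def polyVonMangoldt (g : F[X]) : ℕ :=
  if IsPrimePow g then (radical g).natDegree else 0

lemma polyVonMangoldt_irreducible_pow {P : F[X]} (hP : Irreducible P) {n : ℕ} (hn : n ≠ 0) :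
    polyVonMangoldt (P ^ n) = P.natDegree := by
  classical
  rw [polyVonMangoldt, if_pos (hP.prime.isPrimePow.pow hn), radical_pow_of_prime hP.prime hn,
    natDegree_eq_of_degree_eq degree_normalize]

variable (F) in
/-- The finite set of monic polynomials of degree `n` over a finite field. -/
noncomputable def monicPolys [Finite F] (n : ℕ) : Finset F[X] :=
  (finite_setOf_monic_natDegree_eq n).toFinset

@[simp]
lemma mem_monicPolys [Finite F] {n : ℕ} {f : F[X]} :
    f ∈ monicPolys F n ↔ f.Monic ∧ f.natDegree = n := by
  simp [monicPolys]

open Classical in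
/-- The finite set of monic divisors of a nonzero polynomial over a finite field. -/
noncomputable def monicDivisors [Finite F] (f : F[X]) : Finset F[X] :=
  {g ∈ (Finset.range (f.natDegree + 1)).biUnion (monicPolys F) | g ∣ f}

lemma mem_monicDivisors [Finite F] {f g : F[X]} (hf : f ≠ 0) :
    g ∈ monicDivisors f ↔ g.Monic ∧ g ∣ f := by
  simp only [monicDivisors, Finset.mem_filter, Finset.mem_biUnion, Finset.mem_range,
    Order.lt_add_one_iff, mem_monicPolys, exists_eq_right_right']
  exact and_congr_left fun h ↦ and_iff_right (natDegree_le_of_dvd h hf)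

lemma monic_of_mem_normalizedFactors [DecidableEq F] {f P : F[X]}
    (hP : P ∈ normalizedFactors f) : P.Monic := by
  rw [← normalize_normalized_factor P hP]
  exact monic_normalize (irreducible_of_normalized_factor P hP).ne_zero

lemma natDegree_eq_sum_count_mul_natDegree [DecidableEq F] {f : F[X]} (hf : f.Monic) :
    f.natDegree = ∑ P ∈ (normalizedFactors f).toFinset,
      (normalizedFactors f).count P * P.natDegree := by
  conv_lhs => rw [← hf.normalize_eq_self, ← prod_normalizedFactors_eq hf.ne_zero]
  rw [natDegree_multiset_prod_of_monic _ fun P ↦ monic_of_mem_normalizedFactors,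
    Finset.sum_multiset_map_count]
  rfl

lemma pow_dvd_iff_le_count_normalizedFactors [DecidableEq F] {f P : F[X]} (hf : f ≠ 0)
    (hP : Irreducible P) (hPm : P.Monic) {n : ℕ} :
    P ^ n ∣ f ↔ n ≤ (normalizedFactors f).count P := by
  rw [pow_dvd_iff_le_emultiplicity, emultiplicity_eq_count_normalizedFactors hP hf,
    hPm.normalize_eq_self, Nat.cast_le]

lemma eq_and_eq_of_irreducible_pow_eq {P Q : F[X]} {i j : ℕ} (hP : Irreducible P) (hPm : P.Monic)
    (hQ : Irreducible Q) (hQm : Q.Monic) (hi : i ≠ 0) (h : P ^ i = Q ^ j) : P = Q ∧ i = j := by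
  obtain rfl : P = Q := eq_of_monic_of_associated hPm hQm <|
    (Associated.of_eq h).of_pow_associated_of_prime hP.prime hQ.prime (Nat.pos_of_ne_zero hi)
  exact ⟨rfl, pow_injective_of_not_isUnit hP.not_isUnit hP.ne_zero h⟩

lemma exists_irreducible_pow_eq_of_isPrimePow {g : F[X]} (hg : g.Monic) (h : IsPrimePow g) :
    ∃ (P : F[X]) (n : ℕ), Irreducible P ∧ P.Monic ∧ n ≠ 0 ∧ P ^ n = g := by
  classical
  obtain ⟨P, n, hP, hn, rfl⟩ := h
  refine ⟨normalize P, n, (normalize_associated P).symm.irreducible hP.irreducible,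
    monic_normalize hP.ne_zero, hn.ne', ?_⟩
  exact eq_of_monic_of_associated ((monic_normalize hP.ne_zero).pow n) hg
    (normalize_associated P).pow_pow

lemma sum_polyVonMangoldt_monicDivisors [Finite F] {f : F[X]} (hf : f.Monic) :
    ∑ g ∈ monicDivisors f, polyVonMangoldt g = f.natDegree := by
  classical
  set s := normalizedFactors f
  set T : Finset (Σ _ : F[X], ℕ) := s.toFinset.sigma fun P ↦ Finset.Icc 1 (s.count P)
  have mem_T (x : Σ _ : F[X], ℕ) :
      x ∈ T ↔ Irreducible x.1 ∧ x.1.Monic ∧ x.2 ≠ 0 ∧ x.1 ^ x.2 ∣ f := by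
    simp only [T, Finset.mem_sigma, Multiset.mem_toFinset, Finset.mem_Icc]
    refine ⟨fun ⟨hx, h1, hle⟩ ↦ ?_, fun ⟨hP, hPm, h0, hdvd⟩ ↦ ?_⟩
    · have hP := irreducible_of_normalized_factor _ hx
      have hPm := monic_of_mem_normalizedFactors hx
      exact ⟨hP, hPm, Nat.ne_of_gt h1,
        (pow_dvd_iff_le_count_normalizedFactors hf.ne_zero hP hPm).2 hle⟩
    · have hle := (pow_dvd_iff_le_count_normalizedFactors hf.ne_zero hP hPm).1 hdvd
      exact ⟨Multiset.count_pos.1 ((Nat.pos_of_ne_zero h0).trans_le hle),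
        Nat.pos_of_ne_zero h0, hle⟩
  calc ∑ g ∈ monicDivisors f, polyVonMangoldt g
      = ∑ g ∈ monicDivisors f with IsPrimePow g, polyVonMangoldt g :=
        (Finset.sum_filter_of_ne fun g _ h ↦ by_contra fun h' ↦ h (if_neg h')).symm
    _ = ∑ x ∈ T, x.1.natDegree := by
        symm
        refine Finset.sum_bij (fun x _ ↦ x.1 ^ x.2) (fun x hx ↦ ?_) (fun x hx y hy h ↦ ?_)
          (fun g hg ↦ ?_) (fun x hx ↦ ?_)
        · obtain ⟨hP, hPm, h0, hdvd⟩ := (mem_T x).1 hx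
          exact Finset.mem_filter.2 ⟨(mem_monicDivisors hf.ne_zero).2 ⟨hPm.pow _, hdvd⟩,
            hP.prime.isPrimePow.pow h0⟩
        · obtain ⟨hP, hPm, h0, -⟩ := (mem_T x).1 hx
          obtain ⟨hQ, hQm, -⟩ := (mem_T y).1 hy
          obtain ⟨h1, h2⟩ := eq_and_eq_of_irreducible_pow_eq hP hPm hQ hQm h0 h
          exact Sigma.ext h1 (heq_of_eq h2)
        · rw [Finset.mem_filter, mem_monicDivisors hf.ne_zero] at hg
          obtain ⟨P, n, hP, hPm, hn, rfl⟩ := exists_irreducible_pow_eq_of_isPrimePow hg.1.1 hg.2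
          exact ⟨⟨P, n⟩, (mem_T _).2 ⟨hP, hPm, hn, hg.1.2⟩, rfl⟩
        · obtain ⟨hP, -, h0, -⟩ := (mem_T x).1 hx
          exact (polyVonMangoldt_irreducible_pow hP h0).symm
    _ = f.natDegree := by
        simp only [T, natDegree_eq_sum_count_mul_natDegree hf, Finset.sum_sigma, Finset.sum_const,
          Nat.card_Icc, Nat.add_sub_cancel, smul_eq_mul, s]

lemma sum_monicPolys_sum_monicDivisors [Finite F] {M : Type*} [AddCommMonoid M]
    (φ : F[X] → F[X] → M) (n : ℕ) :
    ∑ f ∈ monicPolys F n, ∑ g ∈ monicDivisors f, φ f g =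
      ∑ x ∈ antidiagonal n, ∑ g ∈ monicPolys F x.1, ∑ h ∈ monicPolys F x.2,
        φ (g * h) g := by
  simp only [← Finset.sum_product', Finset.sum_sigma']
  symm
  refine Finset.sum_bij (fun x _ ↦ ⟨x.2.1 * x.2.2, x.2.1⟩) ?_ ?_ ?_ fun _ _ ↦ rfl
  · rintro ⟨⟨i, j⟩, g, h⟩ hx
    simp only [Finset.mem_sigma, mem_antidiagonal, Finset.mem_product, mem_monicPolys] at hx
    obtain ⟨rfl, ⟨hg, rfl⟩, hh, rfl⟩ := hx
    simp [mem_monicDivisors (hg.mul hh).ne_zero, hg.mul hh, hg, hg.natDegree_mul hh]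
  · rintro ⟨⟨i, j⟩, g, h⟩ hx ⟨⟨i', j'⟩, g', h'⟩ hy hxy
    simp only [Finset.mem_sigma, mem_antidiagonal, Finset.mem_product, mem_monicPolys] at hx hy
    simp only [Sigma.mk.injEq, heq_eq_eq] at hxy
    obtain ⟨-, ⟨hg, rfl⟩, -, rfl⟩ := hx
    obtain ⟨-, ⟨-, rfl⟩, -, rfl⟩ := hy
    obtain ⟨hmul, rfl⟩ := hxy
    obtain rfl := mul_left_cancel₀ hg.ne_zero hmul
    rfl
  · rintro ⟨f, g⟩ hx
    simp only [Finset.mem_sigma, mem_monicPolys] at hx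
    obtain ⟨⟨hf, rfl⟩, hdvd⟩ := hx
    obtain ⟨hg, h, rfl⟩ := (mem_monicDivisors hf.ne_zero).1 hdvd
    have hh := hg.of_mul_monic_left hf
    exact ⟨⟨(g.natDegree, h.natDegree), g, h⟩, by simp [hg, hh, hg.natDegree_mul hh], rfl⟩

/- With `L = ∑ φ f T ^ deg f`, this is the coefficient of `T ^ n` in `T L' = (T L' / L) L`. -/
lemma natCast_mul_sum_monicPolys [Finite F] {R : Type*} [CommSemiring R] {φ : F[X] → R}
    (hφ : ∀ f g : F[X], f.Monic → g.Monic → φ (f * g) = φ f * φ g) (n : ℕ) :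
    n * ∑ f ∈ monicPolys F n, φ f = ∑ x ∈ antidiagonal n,
      (∑ g ∈ monicPolys F x.1, polyVonMangoldt g * φ g) * ∑ h ∈ monicPolys F x.2, φ h := by
  calc n * ∑ f ∈ monicPolys F n, φ f
      = ∑ f ∈ monicPolys F n, ∑ g ∈ monicDivisors f, polyVonMangoldt g * φ f := by
        rw [Finset.mul_sum]
        refine Finset.sum_congr rfl fun f hf ↦ ?_
        obtain ⟨hfm, rfl⟩ := mem_monicPolys.1 hf
        rw [← Finset.sum_mul, ← Nat.cast_sum, sum_polyVonMangoldt_monicDivisors hfm]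
    _ = _ := by
        rw [sum_monicPolys_sum_monicDivisors (fun f g ↦ (polyVonMangoldt g : R) * φ f)]
        refine Finset.sum_congr rfl fun x _ ↦ ?_
        rw [Finset.sum_mul_sum]
        refine Finset.sum_congr rfl fun g hg ↦ Finset.sum_congr rfl fun h hh ↦ ?_
        rw [hφ g h (mem_monicPolys.1 hg).1 (mem_monicPolys.1 hh).1, mul_assoc]

end MonicPolynomials

section HasseDavenport

open Polynomial Module

open scoped IntermediateField

variable {F : Type*} [Field F] {R : Type*} [CommRing R] (χ : MulChar F R) (ψ : AddChar F R)

/-- The function `f ↦ χ(N) ψ(T)` on monic polynomials, where `N` and `T` are the product and the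
sum of the roots of `f`; it is multiplicative. -/
noncomputable def polyChar (f : F[X]) : R :=
  χ ((-1) ^ f.natDegree * f.coeff 0) * ψ (-f.nextCoeff)

lemma polyChar_one : polyChar χ ψ 1 = 1 := by
  simp [polyChar, nextCoeff]

lemma polyChar_mul {f g : F[X]} (hf : f.Monic) (hg : g.Monic) :
    polyChar χ ψ (f * g) = polyChar χ ψ f * polyChar χ ψ g := by
  rw [polyChar, polyChar, polyChar, hf.natDegree_mul hg, hf.nextCoeff_mul hg, mul_coeff_zero,
    neg_add, AddChar.map_add_eq_mul, pow_add, mul_mul_mul_comm, map_mul, mul_mul_mul_comm]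

lemma polyChar_pow {f : F[X]} (hf : f.Monic) (n : ℕ) :
    polyChar χ ψ (f ^ n) = polyChar χ ψ f ^ n := by
  induction n with
  | zero => simp only [pow_zero, polyChar_one]
  | succ n ih => rw [pow_succ, polyChar_mul χ ψ (hf.pow n) hf, ih, pow_succ]

lemma polyChar_minpoly_pow {K : Type*} [Field K] [Algebra F K] [FiniteDimensional F K] (α : K) :
    polyChar χ ψ (minpoly F α ^ finrank F⟮α⟯ K) =
      χ (Algebra.norm F α) * ψ (Algebra.trace F K α) := by
  have hα : IsIntegral F α := .of_finite F α
  have hnorm := Algebra.PowerBasis.norm_gen_eq_coeff_zero_minpoly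
    (IntermediateField.adjoin.powerBasis hα)
  rw [IntermediateField.adjoin.powerBasis_gen, IntermediateField.adjoin.powerBasis_dim,
    IntermediateField.minpoly_gen] at hnorm
  rw [polyChar_pow χ ψ (minpoly.monic hα), polyChar, mul_pow, ← map_pow,
    ← AddChar.map_nsmul_eq_pow, Algebra.norm_eq_norm_adjoin, hnorm,
    trace_eq_finrank_mul_minpoly_nextCoeff, nsmul_eq_mul, mul_neg]

section Finite

variable [Finite F]

lemma monicPolys_zero : monicPolys F 0 = {1} := by
  ext f
  rw [mem_monicPolys, Finset.mem_singleton]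
  exact ⟨fun h ↦ h.1.natDegree_eq_zero.1 h.2, by rintro rfl; exact ⟨monic_one, natDegree_one⟩⟩

lemma sum_monicPolys_zero_polyChar : ∑ f ∈ monicPolys F 0, polyChar χ ψ f = 1 := by
  rw [monicPolys_zero, Finset.sum_singleton, polyChar_one]

lemma add_C_mem_monicPolys {n : ℕ} (hn : n ≠ 0) {f : F[X]} (hf : f ∈ monicPolys F n) (c : F) :
    f + C c ∈ monicPolys F n := by
  obtain ⟨hm, rfl⟩ := mem_monicPolys.1 hf
  have hlt : (C c).degree < f.degree :=
    degree_C_le.trans_lt (natDegree_pos_iff_degree_pos.1 (Nat.pos_of_ne_zero hn))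
  exact mem_monicPolys.2 ⟨hm.add_of_left hlt, natDegree_add_C⟩

lemma nextCoeff_add_C {R : Type*} [Semiring R] {f : R[X]} (hf : 2 ≤ f.natDegree) (c : R) :
    (f + C c).nextCoeff = f.nextCoeff := by
  rw [nextCoeff_of_natDegree_pos (by rw [natDegree_add_C]; omega),
    nextCoeff_of_natDegree_pos (by omega), natDegree_add_C, coeff_add, coeff_C,
    if_neg (by omega), add_zero]

variable {χ}

lemma sum_monicPolys_polyChar_eq_zero [IsDomain R] (hχ : χ ≠ 1) {n : ℕ} (hn : 2 ≤ n) :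
    ∑ f ∈ monicPolys F n, polyChar χ ψ f = 0 := by
  obtain ⟨u, hu⟩ := MulChar.ne_one_iff.1 hχ
  -- Multiplying the constant coefficient by `u` permutes the monic polynomials of degree `n`.
  have scale_mem (v : F) (f : F[X]) (hf : f ∈ monicPolys F n) :
      f + C ((v - 1) * f.coeff 0) ∈ monicPolys F n := add_C_mem_monicPolys (by omega) hf _
  have scale_scale (v w : F) (hvw : w * v = 1) (f : F[X]) :
      f + C ((v - 1) * f.coeff 0) + C ((w - 1) * (f + C ((v - 1) * f.coeff 0)).coeff 0) = f := by
    rw [add_assoc, ← C_add, coeff_add, coeff_C_zero,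
      show (v - 1) * f.coeff 0 + (w - 1) * (f.coeff 0 + (v - 1) * f.coeff 0) = 0 by
        linear_combination f.coeff 0 * hvw, C_0, add_zero]
  have polyChar_scale (f : F[X]) (hf : f ∈ monicPolys F n) :
      χ u * polyChar χ ψ f = polyChar χ ψ (f + C ((u - 1) * f.coeff 0)) := by
    rw [polyChar, polyChar, nextCoeff_add_C (hn.trans (mem_monicPolys.1 hf).2.ge),
      natDegree_add_C, coeff_add, coeff_C_zero, ← mul_assoc, ← map_mul]
    ring_nf
  have hsum : χ u * ∑ f ∈ monicPolys F n, polyChar χ ψ f =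
      ∑ f ∈ monicPolys F n, polyChar χ ψ f := by
    rw [Finset.mul_sum]
    exact Finset.sum_bij' _ _ (scale_mem u) (scale_mem ↑u⁻¹)
      (fun f _ ↦ scale_scale _ _ u.inv_mul f) (fun f _ ↦ scale_scale _ _ u.mul_inv f)
      polyChar_scale
  exact (mul_left_eq_self₀.1 hsum).resolve_left hu

lemma sum_monicPolys_one_polyChar [Fintype F] :
    ∑ f ∈ monicPolys F 1, polyChar χ ψ f = gaussSum χ ψ := by
  refine (Finset.sum_bij (fun a _ ↦ X - C a) ?_ ?_ ?_ ?_).symm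
  · exact fun a _ ↦ mem_monicPolys.2 ⟨monic_X_sub_C a, natDegree_X_sub_C a⟩
  · exact fun a _ b _ h ↦ C_injective (sub_right_injective h)
  · intro f hf
    obtain ⟨hm, hd⟩ := mem_monicPolys.1 hf
    refine ⟨-f.coeff 0, Finset.mem_univ _, ?_⟩
    rw [C_neg, sub_neg_eq_add, ← hm.eq_X_add_C hd]
  · intro a _
    simp [polyChar]

lemma sum_polyVonMangoldt_mul_polyChar [Fintype F] [IsDomain R] (hχ : χ ≠ 1) (n : ℕ) :
    ∑ g ∈ monicPolys F (n + 1), polyVonMangoldt g * polyChar χ ψ g =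
      (-1) ^ n * gaussSum χ ψ ^ (n + 1) := by
  have newton := natCast_mul_sum_monicPolys (φ := polyChar χ ψ) fun f g ↦ polyChar_mul χ ψ
  induction n with
  | zero =>
    have := newton 1
    simpa [Finset.Nat.antidiagonal_succ, sum_monicPolys_one_polyChar, monicPolys_zero, polyChar_one,
      polyVonMangoldt, not_isPrimePow_one] using this.symm
  | succ n ih =>
    have vanish (j : ℕ) (a : R) : a * ∑ f ∈ monicPolys F (j + 1 + 1), polyChar χ ψ f = 0 := by
      rw [sum_monicPolys_polyChar_eq_zero ψ hχ (by omega), mul_zero]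
    have := newton (n + 2)
    simp only [Finset.Nat.sum_antidiagonal_succ', vanish, Finset.sum_const_zero, add_zero,
      zero_add, sum_monicPolys_zero_polyChar, sum_monicPolys_one_polyChar, ih] at this
    linear_combination -this

end Finite

variable (K : Type*) [Field K] [Algebra F K]

lemma splits_map_algebraMap_of_natDegree_dvd_finrank [Finite F] [Finite K] {P : F[X]}
    (hP : Irreducible P) (hd : P.natDegree ∣ finrank F K) : (P.map (algebraMap F K)).Splits := by
  have := Fintype.ofFinite K
  have hdvd : P ∣ X ^ Fintype.card K - X := by
    rw [← Nat.card_eq_fintype_card, Module.natCard_eq_pow_finrank (K := F) (V := K)]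
    exact hP.natDegree_dvd_iff_dvd_X_pow_card_pow_sub_X.1 hd
  have hsplits : (X ^ Fintype.card K - X : K[X]).Splits := by
    rw [splits_iff_card_roots, FiniteField.roots_X_pow_card_sub_X,
      FiniteField.X_pow_card_sub_X_natDegree_eq K Fintype.one_lt_card]
    rfl
  exact hsplits.of_dvd (FiniteField.X_pow_card_sub_X_ne_zero K Fintype.one_lt_card)
    (by simpa using Polynomial.map_dvd (algebraMap F K) hdvd)

variable [Fintype K]

open scoped Classical in
lemma card_filter_minpoly_eq [Finite F] {P : F[X]} (hP : Irreducible P) (hPm : P.Monic)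
    (hd : P.natDegree ∣ finrank F K) :
    ({α | minpoly F α = P} : Finset K).card = P.natDegree := by
  rw [← card_rootSet_eq_natDegree (PerfectField.separable_of_irreducible hP)
    (splits_map_algebraMap_of_natDegree_dvd_finrank K hP hd), ← Set.toFinset_card]
  congr 1
  ext α
  rw [Finset.mem_filter_univ, Set.mem_toFinset, mem_rootSet]
  exact ⟨by rintro rfl; exact ⟨hP.ne_zero, minpoly.aeval F α⟩,
    fun h ↦ (minpoly.eq_of_irreducible_of_monic hP h.2 hPm).symm⟩

open scoped Classical in
lemma card_filter_minpoly_pow_eq [Finite F] {g : F[X]} (hg : g ∈ monicPolys F (finrank F K)) :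
    ({α | minpoly F α ^ finrank F⟮α⟯ K = g} : Finset K).card = polyVonMangoldt g := by
  obtain ⟨hgm, hgd⟩ := mem_monicPolys.1 hg
  have irreducible_minpoly (α : K) : Irreducible (minpoly F α) :=
    minpoly.irreducible (.of_finite F α)
  have natDegree_mul (α : K) : (minpoly F α).natDegree * finrank F⟮α⟯ K = finrank F K := by
    rw [← IntermediateField.adjoin.finrank (.of_finite F α), finrank_mul_finrank]
  by_cases h : IsPrimePow g
  · obtain ⟨P, n, hP, hPm, hn, rfl⟩ := exists_irreducible_pow_eq_of_isPrimePow hgm h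
    rw [natDegree_pow, mul_comm] at hgd
    rw [polyVonMangoldt_irreducible_pow hP hn, ← card_filter_minpoly_eq K hP hPm ⟨n, hgd.symm⟩]
    congr 1
    ext α
    rw [Finset.mem_filter_univ, Finset.mem_filter_univ]
    refine ⟨fun hα ↦ ?_, ?_⟩
    · exact (eq_and_eq_of_irreducible_pow_eq (irreducible_minpoly α)
        (minpoly.monic (.of_finite F α)) hP hPm finrank_pos.ne' hα).1
    · rintro rfl
      rw [Nat.eq_of_mul_eq_mul_left hP.natDegree_pos ((natDegree_mul α).trans hgd.symm)]
  · rw [polyVonMangoldt, if_neg h, Finset.card_eq_zero, Finset.filter_eq_empty_iff]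
    rintro α - rfl
    exact h ((irreducible_minpoly α).prime.isPrimePow.pow finrank_pos.ne')

theorem sum_norm_mul_trace_eq_gaussSum_pow [Fintype F] [IsDomain R] {χ : MulChar F R} (hχ : χ ≠ 1)
    (ψ : AddChar F R) :
    ∑ α : K, χ (Algebra.norm F α) * ψ (Algebra.trace F K α) =
      (-1) ^ (finrank F K - 1) * gaussSum χ ψ ^ finrank F K := by
  classical
  calc ∑ α : K, χ (Algebra.norm F α) * ψ (Algebra.trace F K α)
      = ∑ α : K, polyChar χ ψ (minpoly F α ^ finrank F⟮α⟯ K) := by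
        simp only [polyChar_minpoly_pow]
    _ = ∑ g ∈ monicPolys F (finrank F K), ∑ α : K with minpoly F α ^ finrank F⟮α⟯ K = g,
          polyChar χ ψ g := by
        rw [Finset.sum_fiberwise_of_maps_to']
        intro α _
        have hα : IsIntegral F α := .of_finite F α
        rw [mem_monicPolys, natDegree_pow, mul_comm, ← IntermediateField.adjoin.finrank hα,
          finrank_mul_finrank]
        exact ⟨(minpoly.monic hα).pow _, rfl⟩
    _ = ∑ g ∈ monicPolys F (finrank F K), polyVonMangoldt g * polyChar χ ψ g := by
        refine Finset.sum_congr rfl fun g hg ↦ ?_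
        rw [Finset.sum_const, card_filter_minpoly_pow_eq K hg, nsmul_eq_mul]
    _ = (-1) ^ (finrank F K - 1) * gaussSum χ ψ ^ finrank F K := by
        have := sum_polyVonMangoldt_mul_polyChar ψ hχ (finrank F K - 1)
        rwa [Nat.sub_add_cancel finrank_pos] at this

end HasseDavenport

section PowInverse

/-- `x ↦ x ^ e` is inverse to `x ↦ x ^ d` on `M`. On a finite field such an `e` exists as soon as
`d` is positive and coprime to the order of the unit group. -/
def PowInverse (M : Type*) [Monoid M] (d e : ℕ) : Prop :=
  ∀ x : M, (x ^ d) ^ e = x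

/-- The `d`-th power map is additive. For a finite field of characteristic `p` and order `q` and an
exponent `0 < d` coprime to `q - 1`, this says that `d` is congruent to a power of `p` modulo
`q - 1`. -/
def IsDegenerateExponent (R : Type*) [Semiring R] (d : ℕ) : Prop :=
  ∀ x y : R, (x + y) ^ d = x ^ d + y ^ d

namespace PowInverse

variable {d e : ℕ}

lemma symm {M : Type*} [Monoid M] (h : PowInverse M d e) : PowInverse M e d := fun x ↦ by
  rw [pow_right_comm, h]

lemma bijective {M : Type*} [Monoid M] (h : PowInverse M d e) :
    Function.Bijective fun x : M ↦ x ^ d :=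
  Function.bijective_iff_has_inverse.2 ⟨fun x ↦ x ^ e, h, h.symm⟩

lemma ne_zero {M : Type*} [MonoidWithZero M] [Nontrivial M] (h : PowInverse M d e) : d ≠ 0 := by
  rintro rfl
  have h01 : (0 : M) = 1 := by rw [← h 0, pow_zero, one_pow]
  exact zero_ne_one h01

lemma neg_pow {R : Type*} [Ring R] (h : PowInverse R d e) (x : R) : (-x) ^ d = -x ^ d := by
  rcases Nat.even_or_odd d with hd | hd
  · have h1 : (-1 : R) = 1 := by rw [← h (-1), hd.neg_one_pow, one_pow]
    rw [hd.neg_pow, ← neg_one_mul (x ^ d), h1, one_mul]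
  · exact hd.neg_pow x

lemma of_ringHom {F K : Type*} [Field F] [Field K] (f : F →+* K) (h : PowInverse K d e) :
    PowInverse F d e := fun x ↦
  f.injective (by rw [map_pow, map_pow, h])

end PowInverse

lemma exists_powInverse {K : Type*} [Field K] [Fintype K] {d : ℕ} (hd0 : d ≠ 0)
    (hd : d.Coprime (Fintype.card K - 1)) : ∃ e : ℕ, PowInverse K d e := by
  have hpos : 0 < Fintype.card K - 1 := Nat.sub_pos_of_lt Fintype.one_lt_card
  obtain ⟨e, he0, he⟩ : ∃ e : ℕ, e ≠ 0 ∧ d * e ≡ 1 [MOD Fintype.card K - 1] := by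
    refine ⟨d ^ (Nat.totient (Fintype.card K - 1) - 1), pow_ne_zero _ hd0, ?_⟩
    rw [mul_pow_sub_one (Nat.totient_pos.2 hpos).ne']
    exact Nat.ModEq.pow_totient hd
  refine ⟨e, fun x ↦ ?_⟩
  rw [← pow_mul]
  rcases eq_or_ne x 0 with rfl | hx
  · exact zero_pow (mul_ne_zero hd0 he0)
  · lift x to Kˣ using hx.isUnit
    have horder : orderOf x ∣ Fintype.card K - 1 := orderOf_dvd_of_pow_eq_one <| Units.ext <| by
      simpa using FiniteField.pow_card_sub_one_eq_one (x : K) x.ne_zero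
    have hx : x ^ (d * e) = x := by
      simpa using pow_eq_pow_iff_modEq.2 (he.of_dvd horder)
    simpa using congrArg Units.val hx

end PowInverse

section BinomialSum

variable {K : Type*} [Field K] [Fintype K] {R : Type*} [CommRing R] (ψ : AddChar K R)

/-- The Weil sum of the binomials `x ^ d + a x` with respect to an arbitrary additive character;
`weilSum` is the case of the canonical character. -/
def binomialSum (d : ℕ) (a : K) : R :=
  ∑ x : K, ψ (x ^ d + a * x)

lemma binomialSum_eq_sum_mul (d : ℕ) (a : K) :
    binomialSum ψ d a = ∑ x, ψ (x ^ d) * ψ (a * x) := by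
  simp only [binomialSum, AddChar.map_add_eq_mul]

lemma sum_binomialSum_mul (d : ℕ) (g : K → R) :
    ∑ a, binomialSum ψ d a * g a = ∑ x, ψ (x ^ d) * ∑ a, g a * ψ (a * x) := by
  simp_rw [binomialSum_eq_sum_mul, Finset.sum_mul, Finset.mul_sum]
  rw [Finset.sum_comm]
  exact Finset.sum_congr rfl fun x _ ↦ Finset.sum_congr rfl fun a _ ↦ by ring

variable [IsDomain R] {ψ} {d e : ℕ}

lemma sum_addChar_eq_zero (hψ : ψ.IsPrimitive) : ∑ x, ψ x = 0 := by
  classical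
  simpa using AddChar.sum_mulShift 1 hψ

lemma binomialSum_zero (hde : PowInverse K d e) (hψ : ψ.IsPrimitive) :
    binomialSum ψ d 0 = 0 := by
  simp only [binomialSum, zero_mul, add_zero]
  rw [hde.bijective.sum_comp ψ, sum_addChar_eq_zero hψ]

lemma binomialSum_exponent_zero (hψ : ψ.IsPrimitive) {a : K} (ha : a ≠ 0) :
    binomialSum ψ 0 a = 0 := by
  simp only [binomialSum_eq_sum_mul, pow_zero]
  rw [← Finset.mul_sum, (mulLeft_bijective₀ a ha).sum_comp ψ, sum_addChar_eq_zero hψ, mul_zero]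

lemma sum_binomialSum_mul_apply (hψ : ψ.IsPrimitive) (d : ℕ) (b : K) :
    ∑ a, binomialSum ψ d a * ψ (a * b) = Fintype.card K * ψ ((-b) ^ d) := by
  classical
  simp_rw [sum_binomialSum_mul, ← AddChar.map_add_eq_mul, ← mul_add, AddChar.sum_mulShift _ hψ,
    add_comm b, add_eq_zero_iff_eq_neg]
  simp [mul_comm]

lemma sum_binomialSum (hd : d ≠ 0) (hψ : ψ.IsPrimitive) :
    ∑ a, binomialSum ψ d a = Fintype.card K := by
  simpa [zero_pow hd] using sum_binomialSum_mul_apply hψ d 0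

lemma sum_binomialSum_sq (hde : PowInverse K d e) (hψ : ψ.IsPrimitive) :
    ∑ a, binomialSum ψ d a ^ 2 = (Fintype.card K : R) ^ 2 := by
  simp_rw [sq (binomialSum ψ d _)]
  rw [sum_binomialSum_mul]
  simp_rw [sum_binomialSum_mul_apply hψ, mul_left_comm, ← AddChar.map_add_eq_mul, hde.neg_pow,
    add_neg_cancel, AddChar.map_zero_eq_one]
  simp [sq]

lemma sum_binomialSum_pow_three (hde : PowInverse K d e) (hψ : ψ.IsPrimitive) :
    ∑ a, binomialSum ψ d a ^ 3 =
      Fintype.card K * ∑ y, ∑ x, ψ (x ^ d + y ^ d - (x + y) ^ d) := by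
  have inner (y : K) : ∑ a, binomialSum ψ d a ^ 2 * ψ (a * y) =
      Fintype.card K * ∑ x, ψ (x ^ d - (x + y) ^ d) := by
    simp_rw [sq, mul_assoc, sum_binomialSum_mul, Finset.mul_sum]
    refine Finset.sum_congr rfl fun x _ ↦ ?_
    rw [← Finset.mul_sum]
    simp_rw [mul_assoc, ← AddChar.map_add_eq_mul, ← mul_add, sum_binomialSum_mul_apply hψ,
      hde.neg_pow, sub_eq_add_neg, AddChar.map_add_eq_mul, add_comm y]
    ring
  simp_rw [pow_succ' (binomialSum ψ d _) 2, sum_binomialSum_mul, inner, Finset.mul_sum]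
  refine Finset.sum_congr rfl fun y _ ↦ Finset.sum_congr rfl fun x _ ↦ ?_
  rw [add_comm (x ^ d), add_sub_assoc, AddChar.map_add_eq_mul, mul_left_comm]

open scoped Classical in
lemma sum_sum_apply_pow_add_pow_sub (hde : PowInverse K d e) (hψ : ψ.IsPrimitive) :
    ∑ y, ∑ x, ψ (x ^ d + y ^ d - (x + y) ^ d) =
      (Fintype.card K : R) * ({u | (u + 1) ^ d = u ^ d + 1} : Finset K).card := by
  have scale (y : K) (hy : y ≠ 0) : ∑ x, ψ (x ^ d + y ^ d - (x + y) ^ d) =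
      ∑ u, ψ (y ^ d * (u ^ d + 1 - (u + 1) ^ d)) := by
    rw [← (mulRight_bijective₀ y hy).sum_comp]
    refine Finset.sum_congr rfl fun u _ ↦ ?_
    rw [← add_one_mul, mul_pow, mul_pow]
    ring_nf
  have erase (b c : K) : ∑ y ∈ Finset.univ.erase 0, ψ (y ^ d * (b - c)) =
      (if c = b then (Fintype.card K : R) else 0) - 1 := by
    rw [Finset.sum_erase_eq_sub (Finset.mem_univ _),
      hde.bijective.sum_comp fun y ↦ ψ (y * (b - c)), AddChar.sum_mulShift _ hψ]
    simp [hde.ne_zero, sub_eq_zero, eq_comm]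
  rw [← Finset.add_sum_erase _ _ (Finset.mem_univ 0),
    Finset.sum_congr rfl fun y hy ↦ scale y (Finset.ne_of_mem_erase hy), Finset.sum_comm]
  simp_rw [erase]
  simp [Finset.sum_sub_distrib, ← Finset.sum_filter, zero_pow hde.ne_zero, mul_comm]

end BinomialSum

section SymmetricSums

lemma isIntegral_addChar_apply {G R : Type*} [AddGroup G] [Finite G] [CommRing R]
    (ψ : AddChar G R) (x : G) : IsIntegral ℤ (ψ x) := by
  refine .of_pow (addOrderOf_pos x) ?_
  rw [← AddChar.map_nsmul_eq_pow, addOrderOf_nsmul_eq_zero, AddChar.map_zero_eq_one]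
  exact isIntegral_one

lemma exists_intCast_eq_of_mul_intCast_eq {L : Type*} [Field L] [CharZero L] {z : L}
    (hz : IsIntegral ℤ z) {m n : ℤ} (hn : n ≠ 0) (h : z * n = m) : ∃ B : ℤ, z = B := by
  have hrat : z = algebraMap ℚ L (m / n) := by
    rw [eq_ratCast, Rat.cast_div, Rat.cast_intCast, Rat.cast_intCast,
      eq_div_iff (Int.cast_ne_zero.2 hn), h]
  rw [hrat, isIntegral_algebraMap_iff (algebraMap ℚ L).injective] at hz
  obtain ⟨B, hB⟩ := IsIntegrallyClosed.isIntegral_iff.1 hz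
  exact ⟨B, by rw [hrat, ← hB]; simp⟩

lemma exists_intCast_dvd_of_symmetric {ι L : Type*} [Fintype ι] [Field L] [CharZero L]
    {f : ι → L} (hf : ∀ i, IsIntegral ℤ (f i)) {A : L} (hA : ∀ i, f i = 0 ∨ f i = A ∨ f i = -A)
    {m : ℤ} (hm : m ≠ 0) (hsum : ∑ i, f i = m) :
    ∃ B : ℤ, A = B ∧ B ∣ m := by
  have hsign (i) : ∃ ε : ℤ, f i = A * ε := by
    rcases hA i with h | h | h
    exacts [⟨0, by simp [h]⟩, ⟨1, by simp [h]⟩, ⟨-1, by simp [h]⟩]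
  choose ε hε using hsign
  have hAsum : A * (∑ i, ε i : ℤ) = m := by
    rw [← hsum, Int.cast_sum, Finset.mul_sum]
    exact Finset.sum_congr rfl fun i _ ↦ (hε i).symm
  have hsum0 : ∑ i, f i ≠ 0 := by rw [hsum]; exact_mod_cast hm
  obtain ⟨i, -, hi⟩ := Finset.exists_ne_zero_of_sum_ne_zero hsum0
  have hAint : IsIntegral ℤ A := by
    rcases hA i with h | h | h
    · exact absurd h hi
    · exact h ▸ hf i
    · exact neg_neg A ▸ h ▸ (hf i).neg
  have hε0 : ∑ i, ε i ≠ 0 := fun h ↦ hm (by simpa [h, eq_comm] using hAsum)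
  obtain ⟨B, rfl⟩ := exists_intCast_eq_of_mul_intCast_eq hAint hε0 hAsum
  exact ⟨B, rfl, _, (mod_cast hAsum.symm)⟩

variable {K : Type*} [Field K] [Fintype K] {d e : ℕ}

lemma isIntegral_binomialSum {R : Type*} [CommRing R] (ψ : AddChar K R) (d : ℕ) (a : K) :
    IsIntegral ℤ (binomialSum ψ d a) :=
  .sum _ fun _ _ ↦ isIntegral_addChar_apply _ _

variable {ψ : AddChar K ℂ}

lemma card_lt_sq_of_norm_binomialSum_le (hde : PowInverse K d e) (hψ : ψ.IsPrimitive) {M : ℝ}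
    (hM : ∀ a, ‖binomialSum ψ d a‖ ≤ M) : Fintype.card K < M ^ 2 := by
  have hcard : (0 : ℝ) < Fintype.card K := mod_cast Fintype.card_pos
  have hle : (Fintype.card K : ℝ) ^ 2 ≤ (Fintype.card K - 1) * M ^ 2 := by
    classical
    calc (Fintype.card K : ℝ) ^ 2 = ‖∑ a, binomialSum ψ d a ^ 2‖ := by
          rw [sum_binomialSum_sq hde hψ, norm_pow, Complex.norm_natCast]
      _ ≤ ∑ a, ‖binomialSum ψ d a‖ ^ 2 :=
          (norm_sum_le _ _).trans_eq (by simp only [norm_pow])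
      _ = ∑ a ∈ Finset.univ.erase 0, ‖binomialSum ψ d a‖ ^ 2 := by
          rw [Finset.sum_erase _ (by simp [binomialSum_zero hde hψ])]
      _ ≤ ∑ _ ∈ Finset.univ.erase (0 : K), M ^ 2 :=
          Finset.sum_le_sum fun a _ ↦ pow_le_pow_left₀ (norm_nonneg _) (hM a) 2
      _ = (Fintype.card K - 1) * M ^ 2 := by
          rw [Finset.sum_const, Finset.card_erase_of_mem (Finset.mem_univ _), Finset.card_univ,
            nsmul_eq_mul, Nat.cast_sub Fintype.card_pos, Nat.cast_one]
  have hMpos : 0 < M ^ 2 := (sq_nonneg M).lt_of_ne fun h ↦ by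
    rw [← h, mul_zero] at hle
    exact (pow_pos hcard 2).not_ge hle
  nlinarith

lemma exists_binomialSum_eq_pow_mul (hde : PowInverse K d e) (hψ : ψ.IsPrimitive) {A : ℂ}
    (hA : ∀ a, binomialSum ψ d a = 0 ∨ binomialSum ψ d a = A ∨ binomialSum ψ d a = -A)
    {p n : ℕ} (hp : p.Prime) (hcard : Fintype.card K = p ^ n) :
    ∃ k, n < 2 * k ∧ ∀ a, ∃ w : ℤ, binomialSum ψ d a = p ^ k * w := by
  obtain ⟨B, rfl, hB⟩ := exists_intCast_dvd_of_symmetric (isIntegral_binomialSum ψ d) hA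
    (m := Fintype.card K) (mod_cast Fintype.card_ne_zero)
    (by simpa using sum_binomialSum hde.ne_zero hψ)
  rw [hcard, ← Int.natAbs_dvd_natAbs, Int.natAbs_natCast] at hB
  obtain ⟨k, -, hk⟩ := (Nat.dvd_prime_pow hp).1 hB
  have hBp : B = p ^ k ∨ B = -p ^ k := by exact_mod_cast hk ▸ B.natAbs_eq
  have hW (a) : ∃ w : ℤ, |w| ≤ 1 ∧ binomialSum ψ d a = p ^ k * w := by
    rcases hA a with h | h | h <;> rcases hBp with rfl | rfl
    exacts [⟨0, by simp [h]⟩, ⟨0, by simp [h]⟩, ⟨1, by simp [h]⟩, ⟨-1, by simp [h]⟩,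
      ⟨-1, by simp [h]⟩, ⟨1, by simp [h]⟩]
  refine ⟨k, ?_, fun a ↦ (hW a).imp fun _ ↦ And.right⟩
  have hlt := card_lt_sq_of_norm_binomialSum_le hde hψ (M := p ^ k) fun a ↦ by
    obtain ⟨w, hw, h⟩ := hW a
    have hw' : |(w : ℝ)| ≤ 1 := mod_cast hw
    rw [h, norm_mul, norm_pow, Complex.norm_natCast, Complex.norm_intCast]
    exact mul_le_of_le_one_right (by positivity) hw'
  rw [hcard, ← pow_mul, mul_comm] at hlt
  exact (Nat.pow_lt_pow_iff_right hp.one_lt).1 (mod_cast hlt)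

lemma card_mul_card_le_norm_sq (hde : PowInverse K d e) (hψ : ψ.IsPrimitive) {A : ℂ}
    (hA : ∀ a, binomialSum ψ d a = 0 ∨ binomialSum ψ d a = A ∨ binomialSum ψ d a = -A)
    {F : Type*} [Field F] [Fintype F] (f : F →+* K) (hF : IsDegenerateExponent F d) :
    (Fintype.card F * Fintype.card K : ℝ) ≤ ‖A‖ ^ 2 := by
  classical
  have hcard : (Fintype.card K : ℂ) ≠ 0 := mod_cast Fintype.card_ne_zero
  have hmoment : A ^ 2 * Fintype.card K =
      Fintype.card K ^ 2 * ({u | (u + 1) ^ d = u ^ d + 1} : Finset K).card := by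
    rw [sq (Fintype.card K : ℂ), mul_assoc, ← sum_sum_apply_pow_add_pow_sub hde hψ,
      ← sum_binomialSum_pow_three hde hψ, ← sum_binomialSum hde.ne_zero hψ, Finset.mul_sum]
    refine Finset.sum_congr rfl fun a _ ↦ ?_
    rcases hA a with h | h | h <;> rw [h] <;> ring
  have hA2 : A ^ 2 = Fintype.card K * ({u | (u + 1) ^ d = u ^ d + 1} : Finset K).card :=
    mul_right_cancel₀ hcard (by rw [hmoment]; ring)
  have hle : Fintype.card F ≤ ({u | (u + 1) ^ d = u ^ d + 1} : Finset K).card := by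
    rw [← Finset.card_univ]
    refine Finset.card_le_card_of_injOn f (fun u _ ↦ ?_) f.injective.injOn
    simpa using congrArg f (hF u 1)
  rw [← norm_pow, hA2, norm_mul, Complex.norm_natCast, Complex.norm_natCast, mul_comm]
  gcongr

end SymmetricSums

section PrimeField

open Polynomial in
lemma aeval_pow_eq_zero_of_coprime {R : Type*} [CommRing R] [IsDomain R] [CharZero R] {ζ : R}
    {n : ℕ} (hζ : IsPrimitiveRoot ζ n) (hn : 0 < n) {P : ℤ[X]} (hP : aeval ζ P = 0) {c : ℕ}
    (hc : c.Coprime n) : aeval (ζ ^ c) P = 0 := by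
  have hdvd := minpoly.isIntegrallyClosed_dvd (hζ.isIntegral hn) hP
  rw [hζ.minpoly_eq_pow_coprime hc] at hdvd
  exact aeval_eq_zero_of_dvd_aeval_eq_zero hdvd (minpoly.aeval ℤ _)

open Polynomial in
lemma sum_mul_pow_eq_mul_pow {ι R : Type*} [Fintype ι] [CommRing R] [IsDomain R] [CharZero R]
    {ζ : R} {n : ℕ} (hζ : IsPrimitiveRoot ζ n) (hn : 0 < n) {z : ι → R} (hz : ∀ i, z i ^ n = 1)
    {z₀ : R} (hz₀ : z₀ ^ n = 1) {w : ι → ℤ} {w₀ : ℤ} (h : ∑ i, w i * z i = w₀ * z₀) {c : ℕ}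
    (hc : c.Coprime n) : ∑ i, w i * z i ^ c = w₀ * z₀ ^ c := by
  have : NeZero n := ⟨hn.ne'⟩
  choose m _ hm using fun i ↦ hζ.eq_pow_of_pow_eq_one (hz i)
  obtain ⟨m₀, -, rfl⟩ := hζ.eq_pow_of_pow_eq_one hz₀
  have hP : aeval ζ (∑ i, C (w i) * X ^ m i - C w₀ * X ^ m₀) = 0 := by
    simpa [hm, sub_eq_zero] using h
  simpa [pow_right_comm ζ c, hm, sub_eq_zero] using aeval_pow_eq_zero_of_coprime hζ hn hP hc

variable {K : Type*} [Field K] [Fintype K] {p d e : ℕ} {ψ : AddChar K ℂ}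

lemma natCast_pow_eq_of_binomialSum_int [CharP K p] (hp : p.Prime) (hde : PowInverse K d e)
    (hψ : ψ.IsPrimitive) (hW : ∀ a, ∃ w : ℤ, binomialSum ψ d a = w) {c : ℕ} (hc : c.Coprime p) :
    (c : K) ^ d = c := by
  have hroot (x : K) : ψ x ^ p = 1 := by
    rw [← AddChar.map_nsmul_eq_pow, nsmul_eq_mul, CharP.cast_eq_zero, zero_mul,
      AddChar.map_zero_eq_one]
  choose w hw using hW
  have hgalois (y : K) : ψ ((c * y) ^ d) = ψ (c * y ^ d) := by
    have hinv (b : K) : ∑ a, (w a : ℂ) * ψ (a * b) = (Fintype.card K : ℤ) * ψ ((-b) ^ d) := by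
      simpa only [hw, Int.cast_natCast] using sum_binomialSum_mul_apply hψ d b
    have hconj := sum_mul_pow_eq_mul_pow (Complex.isPrimitiveRoot_exp p hp.ne_zero) hp.pos
      (fun a ↦ hroot _) (hroot _) (hinv (-y)) hc
    simp only [← AddChar.map_nsmul_eq_pow, nsmul_eq_mul, mul_left_comm (c : K)] at hconj
    rw [hinv, neg_mul_eq_mul_neg, neg_neg] at hconj
    exact mul_left_cancel₀ (by simp) hconj
  refine AddChar.to_mulShift_inj_of_isPrimitive hψ ?_
  ext x
  simpa [mul_pow, hde.symm x] using hgalois (x ^ e)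

lemma pow_eq_self_of_binomialSum_int [Fact p.Prime] [Algebra (ZMod p) K] (hde : PowInverse K d e)
    (hψ : ψ.IsPrimitive) (hW : ∀ a, ∃ w : ℤ, binomialSum ψ d a = w) (x : ZMod p) : x ^ d = x := by
  have : CharP K p := charP_of_injective_algebraMap (algebraMap (ZMod p) K).injective p
  rcases eq_or_ne x 0 with rfl | hx
  · exact zero_pow hde.ne_zero
  · apply (algebraMap (ZMod p) K).injective
    simpa [← map_natCast (algebraMap (ZMod p) K)] using natCast_pow_eq_of_binomialSum_int
      Fact.out hde hψ hW (ZMod.val_coe_unit_coprime (Units.mk0 x hx))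

end PrimeField

section Divisibility

/-- The multiplicative character `χ ∘ N` of an extension `K` of `F`, where `N` is the norm. -/
noncomputable def normLift {F R : Type*} [Field F] [CommRing R] (χ : MulChar F R) (K : Type*)
    [Field K] [Algebra F K] : MulChar K R :=
  .ofUnitHom (χ.toUnitHom.comp (Units.map (Algebra.norm F)))

/-- The additive character `ψ ∘ Tr` of an `F`-algebra `K`, where `Tr` is the trace. -/
noncomputable def traceLift {F R : Type*} [CommRing F] [CommRing R] (ψ : AddChar F R) (K : Type*)
    [CommRing K] [Algebra F K] : AddChar K R :=
  ψ.compAddMonoidHom (Algebra.trace F K).toAddMonoidHom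

lemma ne_one_of_isPrimitive {R R' : Type*} [CommRing R] [Nontrivial R] [CommMonoid R']
    {ψ : AddChar R R'} (hψ : ψ.IsPrimitive) : ψ ≠ 1 := by
  simpa only [AddChar.mulShift_one] using hψ one_ne_zero

section Lifts

variable {F R : Type*} [Field F] [CommRing R] {K : Type*} [Field K] [Algebra F K]

lemma traceLift_apply (ψ : AddChar F R) (x : K) :
    traceLift ψ K x = ψ (Algebra.trace F K x) := rfl

lemma isPrimitive_traceLift [FiniteDimensional F K] [Algebra.IsSeparable F K] {ψ : AddChar F R}
    (hψ : ψ ≠ 1) : (traceLift ψ K).IsPrimitive := by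
  obtain ⟨y, hy⟩ := AddChar.ne_one_iff.1 hψ
  obtain ⟨x, rfl⟩ := Algebra.trace_surjective F K y
  exact .of_ne_one (AddChar.ne_one_iff.2 ⟨x, hy⟩)

lemma traceLift_traceLift {E : Type*} [Field E] [Algebra E F] [Algebra E K] [IsScalarTower E F K]
    [FiniteDimensional E F] [FiniteDimensional F K] (ψ : AddChar E R) :
    traceLift (traceLift ψ F) K = traceLift ψ K := by
  ext x
  simp only [traceLift_apply, Algebra.trace_trace]

variable [Finite K]

lemma normLift_apply (χ : MulChar F R) (x : K) : normLift χ K x = χ (Algebra.norm F x) := by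
  rcases eq_or_ne x 0 with rfl | hx
  · simp [MulChar.map_zero]
  · lift x to Kˣ using hx.isUnit
    simp [normLift]

lemma normLift_ne_one [Finite F] {χ : MulChar F R} (hχ : χ ≠ 1) : normLift χ K ≠ 1 := by
  obtain ⟨u, hu⟩ := MulChar.ne_one_iff.1 hχ
  obtain ⟨v, rfl⟩ := FiniteField.unitsMap_norm_surjective F K u
  exact MulChar.ne_one_iff.2 ⟨v, by rwa [normLift_apply]⟩

lemma normLift_inv_pow (χ : MulChar F R) (e : ℕ) :
    normLift (χ⁻¹ ^ e) K = (normLift χ K)⁻¹ ^ e := by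
  ext x
  have hnorm (y : Kˣ) : Algebra.norm F (y : K) = Units.map (Algebra.norm F) y := rfl
  rw [normLift_apply, hnorm, MulChar.pow_apply_coe, MulChar.pow_apply_coe, MulChar.inv_apply,
    MulChar.inv_apply, Ring.inverse_unit, Ring.inverse_unit, normLift_apply, hnorm, map_inv]

lemma gaussSum_normLift_traceLift [Fintype F] [Fintype K] [IsDomain R] {χ : MulChar F R}
    (hχ : χ ≠ 1) (ψ : AddChar F R) :
    gaussSum (normLift χ K) (traceLift ψ K) =
      (-1) ^ (Module.finrank F K - 1) * gaussSum χ ψ ^ Module.finrank F K := by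
  simp only [gaussSum, normLift_apply, traceLift_apply]
  exact sum_norm_mul_trace_eq_gaussSum_pow K hχ ψ

end Lifts

section MulCharTransform

lemma mulChar_inv_pow_ne_one {F R : Type*} [Field F] [CommRing R]
    {d e : ℕ} (hde : PowInverse F d e) {χ : MulChar F R} (hχ : χ ≠ 1) : χ⁻¹ ^ e ≠ 1 := fun h ↦ by
  refine hχ (inv_eq_one.1 (MulChar.eq_one_iff.2 fun u ↦ ?_))
  have hu := MulChar.eq_one_iff.1 h (u ^ d)
  rwa [MulChar.pow_apply_coe, ← map_pow, Units.val_pow_eq_pow_val, hde] at hu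

lemma sum_mulChar_apply_eq_zero {F R : Type*} [Field F] [Finite F] [CommRing R] [IsDomain R]
    [HasEnoughRootsOfUnity R (Monoid.exponent Fˣ)] [Fintype (MulChar F R)] {a : F} (ha : a ≠ 1) :
    ∑ χ : MulChar F R, χ a = 0 := by
  obtain ⟨η, hη⟩ := MulChar.exists_apply_ne_one_of_hasEnoughRootsOfUnity F R ha
  refine eq_zero_of_mul_eq_self_left hη ?_
  simp only [Finset.mul_sum, ← MulChar.mul_apply]
  exact Fintype.sum_bijective _ (Group.mulLeft_bijective η) _ _ fun _ ↦ rfl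

variable {F : Type*} [Field F] [Fintype F] {R : Type*} [CommRing R] [IsDomain R] {d e : ℕ}

lemma sum_mulChar_mul_addChar_mul {χ : MulChar F R} (hχ : χ ≠ 1) (ψ : AddChar F R) (x : F) :
    ∑ a, χ a * ψ (a * x) = χ⁻¹ x * gaussSum χ ψ := by
  rcases eq_or_ne x 0 with rfl | hx
  · simp [MulChar.sum_eq_zero_of_ne_one hχ, MulChar.map_zero]
  · simpa [gaussSum, mul_comm x] using gaussSum_mulShift_eq χ ψ (Units.mk0 x hx)

lemma sum_binomialSum_mul_mulChar (hde : PowInverse F d e) {χ : MulChar F R} (hχ : χ ≠ 1)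
    (ψ : AddChar F R) :
    ∑ a, binomialSum ψ d a * χ a = gaussSum χ ψ * gaussSum (χ⁻¹ ^ e) ψ := by
  simp_rw [sum_binomialSum_mul, sum_mulChar_mul_addChar_mul hχ]
  rw [gaussSum.eq_def (χ⁻¹ ^ e), Finset.mul_sum, ← hde.bijective.sum_comp fun x ↦
    gaussSum χ ψ * ((χ⁻¹ ^ e) x * ψ x)]
  refine Finset.sum_congr rfl fun x _ ↦ ?_
  rw [MulChar.pow_apply' _ hde.symm.ne_zero, ← map_pow, hde]
  ring

lemma sum_binomialSum_mul_normLift {K : Type*} [Field K] [Fintype K] [Algebra F K]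
    (hde : PowInverse K d e) {χ : MulChar F R} (hχ : χ ≠ 1) (ψ : AddChar F R) :
    ∑ a, binomialSum (traceLift ψ K) d a * normLift χ K a =
      (∑ a, binomialSum ψ d a * χ a) ^ Module.finrank F K := by
  have hdeF : PowInverse F d e := hde.of_ringHom (algebraMap F K)
  rw [sum_binomialSum_mul_mulChar hde (normLift_ne_one hχ), ← normLift_inv_pow,
    gaussSum_normLift_traceLift hχ,
    gaussSum_normLift_traceLift (mulChar_inv_pow_ne_one hdeF hχ), mul_mul_mul_comm, ← mul_pow,
    ← mul_pow, neg_one_mul, neg_neg, one_pow, one_mul, sum_binomialSum_mul_mulChar hdeF hχ]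

variable [HasEnoughRootsOfUnity R (Monoid.exponent Fˣ)]

lemma sum_inv_mul_sum_mul_mulChar [Fintype (MulChar F R)] (f : F → R) {b : F} (hb : b ≠ 0) :
    ∑ χ : MulChar F R, χ⁻¹ b * ∑ a, f a * χ a = (Fintype.card F - 1) * f b := by
  classical
  have hcard : (Fintype.card (MulChar F R) : R) = Fintype.card F - 1 := by
    rw [← Nat.card_eq_fintype_card, MulChar.card_eq_card_units_of_hasEnoughRootsOfUnity,
      Nat.card_units, Nat.card_eq_fintype_card, Nat.cast_sub Fintype.card_pos, Nat.cast_one]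
  simp_rw [Finset.mul_sum, MulChar.inv_apply', mul_left_comm, ← map_mul]
  rw [Finset.sum_comm, Finset.sum_eq_single b]
  · simp [hb, hcard, mul_comm]
  · intro a _ hab
    rw [← Finset.mul_sum, sum_mulChar_apply_eq_zero, mul_zero]
    rwa [inv_mul_eq_div, Ne, div_eq_one_iff_eq hb]
  · simp

lemma card_sub_one_mul_binomialSum [Fintype (MulChar F R)] [DecidableEq (MulChar F R)]
    (hde : PowInverse F d e) {ψ : AddChar F R} (hψ : ψ.IsPrimitive) {b : F} (hb : b ≠ 0) :
    (Fintype.card F - 1) * binomialSum ψ d b = Fintype.card F +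
      ∑ χ ∈ Finset.univ.erase (1 : MulChar F R), χ⁻¹ b * ∑ a, binomialSum ψ d a * χ a := by
  have hone : ∑ a, binomialSum ψ d a * (1 : MulChar F R) a = Fintype.card F := by
    rw [← sum_binomialSum hde.ne_zero hψ]
    refine Finset.sum_congr rfl fun a _ ↦ ?_
    rcases eq_or_ne a 0 with rfl | ha
    · simp [binomialSum_zero hde hψ]
    · rw [MulChar.one_apply ha.isUnit, mul_one]
  rw [← sum_inv_mul_sum_mul_mulChar _ hb, ← Finset.add_sum_erase _ _ (Finset.mem_univ 1), hone,
    inv_one, MulChar.one_apply hb.isUnit, one_mul]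

end MulCharTransform

lemma isIntegral_mulChar_apply {M R : Type*} [CommMonoid M] [Finite M] [CommRing R]
    (χ : MulChar M R) (x : M) : IsIntegral ℤ (χ x) := by
  by_cases hx : IsUnit x
  · obtain ⟨u, rfl⟩ := hx
    refine .of_pow (orderOf_pos u) ?_
    rw [← map_pow, ← Units.val_pow_eq_pow_val, pow_orderOf_eq_one, Units.val_one, map_one]
    exact isIntegral_one
  · rw [χ.map_nonunit hx]
    exact isIntegral_zero

variable {F : Type*} [Field F] [Fintype F] {K : Type*} [Field K] [Fintype K] [Algebra F K]
  {d e : ℕ} {ψ : AddChar F ℂ}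

/- Hasse–Davenport exhibits the `[K : F]`-th power of a multiplicative Fourier coefficient of the
sums over `F` as a Fourier coefficient of the sums over `K`. -/
lemma isIntegral_sum_mul_mulChar_div (hde : PowInverse K d e) {χ : MulChar F ℂ} (hχ : χ ≠ 1)
    {z : ℂ}
    (hz : ∀ a, IsIntegral ℤ (binomialSum (traceLift ψ K) d a / z ^ Module.finrank F K)) :
    IsIntegral ℤ ((∑ a, binomialSum ψ d a * χ a) / z) := by
  refine .of_pow (Module.finrank_pos (R := F) (M := K)) ?_
  rw [div_pow, ← sum_binomialSum_mul_normLift hde hχ, Finset.sum_div]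
  refine .sum _ fun a _ ↦ ?_
  rw [mul_div_right_comm]
  exact (hz a).mul (isIntegral_mulChar_apply _ _)

lemma isIntegral_binomialSum_div (hde : PowInverse K d e) (hψ : ψ.IsPrimitive) {z : ℂ}
    (hcard : IsIntegral ℤ (Fintype.card F / z))
    (hz : ∀ a, IsIntegral ℤ (binomialSum (traceLift ψ K) d a / z ^ Module.finrank F K)) (b : F) :
    IsIntegral ℤ (binomialSum ψ d b / z) := by
  classical
  have : Fintype (MulChar F ℂ) := .ofFinite _
  have hdeF : PowInverse F d e := hde.of_ringHom (algebraMap F K)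
  rcases eq_or_ne b 0 with rfl | hb
  · simpa [binomialSum_zero hdeF hψ] using isIntegral_zero
  have hinv : binomialSum ψ d b / z = Fintype.card F / z * binomialSum ψ d b -
      (Fintype.card F / z + ∑ χ ∈ Finset.univ.erase (1 : MulChar F ℂ),
        χ⁻¹ b * ((∑ a, binomialSum ψ d a * χ a) / z)) := by
    simp_rw [← mul_div_assoc, ← Finset.sum_div, ← add_div]
    rw [← card_sub_one_mul_binomialSum hdeF hψ hb]
    ring
  rw [hinv]
  refine (hcard.mul (isIntegral_binomialSum ψ d b)).sub (hcard.add (.sum _ fun χ hχ ↦ ?_))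
  exact (isIntegral_mulChar_apply _ _).mul
    (isIntegral_sum_mul_mulChar_div hde (Finset.ne_of_mem_erase hχ) hz)

lemma not_isIntegral_inv_natCast {L : Type*} [Field L] [CharZero L] {n : ℕ} (hn : 1 < n) :
    ¬ IsIntegral ℤ (n : L)⁻¹ := fun h ↦ by
  have hn0 : (n : L) ≠ 0 := mod_cast (zero_lt_one.trans hn).ne'
  obtain ⟨B, hB⟩ := exists_intCast_eq_of_mul_intCast_eq h (m := 1) (n := n) (by lia) (by simp [hn0])
  have hBn : B * n = 1 := by exact_mod_cast hB ▸ inv_mul_cancel₀ hn0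
  have hdvd := Int.le_of_dvd one_pos (Dvd.intro_left B hBn)
  lia

lemma binomialSum_ne_neg_pow (hde : PowInverse K d e) (hψ : ψ.IsPrimitive) {p h k : ℕ}
    (hp : 1 < p) (hh : h ≠ 0) (hcard : Fintype.card F = p ^ (2 * h))
    (hk : h * Module.finrank F K < k)
    (hW : ∀ a, ∃ w : ℤ, binomialSum (traceLift ψ K) d a = p ^ k * w) (b : F) :
    binomialSum ψ d b ≠ -p ^ h := fun hb ↦ by
  have hm : 0 < Module.finrank F K := Module.finrank_pos
  have hp0 : (p : ℂ) ≠ 0 := mod_cast (zero_lt_one.trans hp).ne'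
  obtain ⟨π, hπ⟩ := IsAlgClosed.exists_pow_nat_eq (p : ℂ) hm
  have hπ0 : π ≠ 0 := by
    rintro rfl
    exact hp0 (by rw [← hπ, zero_pow hm.ne'])
  have hπint : IsIntegral ℤ π := .of_pow hm (hπ ▸ isIntegral_natCast p)
  have hint := isIntegral_binomialSum_div (z := p ^ h * π) hde hψ ?_ (fun a ↦ ?_) b
  · have hinv : -p ^ h / (p ^ h * π) = -π⁻¹ := by field_simp
    rw [hb, hinv] at hint
    refine not_isIntegral_inv_natCast (L := ℂ) hp ?_
    simpa [← hπ] using hint.neg.pow (Module.finrank F K)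
  · have hq : (Fintype.card F : ℂ) / (p ^ h * π) =
        p ^ (h - 1) * π ^ (Module.finrank F K - 1) := by
      rw [div_eq_iff (by positivity), hcard]
      calc ((p ^ (2 * h) : ℕ) : ℂ) = p ^ (h - 1) * p * p ^ h := by
            rw [pow_sub_one_mul hh, ← pow_add, two_mul, Nat.cast_pow]
        _ = p ^ (h - 1) * (π ^ (Module.finrank F K - 1) * π) * p ^ h := by
            rw [pow_sub_one_mul hm.ne', hπ]
        _ = _ := by ring
    rw [hq]
    exact ((isIntegral_natCast p).pow _).mul (hπint.pow _)
  · obtain ⟨w, hw⟩ := hW a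
    have hdiv : binomialSum (traceLift ψ K) d a / (p ^ h * π) ^ Module.finrank F K =
        p ^ (k - (h * Module.finrank F K + 1)) * w := by
      rw [hw, mul_pow, hπ, ← pow_mul, ← pow_succ, div_eq_iff (pow_ne_zero _ hp0), mul_right_comm,
        ← pow_add, Nat.sub_add_cancel hk]
    rw [hdiv]
    exact ((isIntegral_natCast p).pow _).mul (isIntegral_intCast w)

end Divisibility

section QuadraticStep

section Plane

variable {L V : Type*} [Field L] [AddCommGroup V] [Module L V] {f : V → L}

lemma surjective_map_add_smul_sub_mul (hV : Module.finrank L V = 2)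
    (hf : ∀ (r : L) (x : V), f (r • x) = r * f x)
    (hφ : ∀ φ : V →ₗ[L] L, ∃ z, z ≠ 0 ∧ f z = φ z) {x y : V}
    (hli : LinearIndependent L ![y, x]) {c : L} (hc : c ≠ f y) :
    Function.Surjective fun s : L ↦ f (x + s • y) - s * c := fun v ↦ by
  let B := basisOfLinearIndependentOfCardEqFinrank hli (by simp [hV])
  have hBy : B 0 = y := by simp [B]
  have hBx : B 1 = x := by simp [B]
  obtain ⟨φ, hφy, hφx⟩ : ∃ φ : V →ₗ[L] L, φ y = c ∧ φ x = v :=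
    ⟨B.constr L ![c, v], by rw [← hBy, B.constr_basis]; rfl, by rw [← hBx, B.constr_basis]; rfl⟩
  obtain ⟨z, hz0, hfz⟩ := hφ φ
  obtain ⟨α, β, rfl⟩ : ∃ α β : L, z = α • y + β • x :=
    ⟨B.repr z 0, B.repr z 1, by rw [← hBy, ← hBx, ← Fin.sum_univ_two fun i ↦ B.repr z i • B i,
      B.sum_repr]⟩
  have hβ : β ≠ 0 := by
    rintro rfl
    have hα : α ≠ 0 := by
      rintro rfl
      simp at hz0
    rw [zero_smul, add_zero, hf, map_smul, hφy, smul_eq_mul] at hfz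
    exact hc (mul_left_cancel₀ hα hfz).symm
  have hscale : α • y + β • x = β • (x + (β⁻¹ * α) • y) := by
    rw [smul_add, smul_smul, mul_inv_cancel_left₀ hβ, add_comm]
  rw [hscale, hf, map_smul, smul_eq_mul] at hfz
  refine ⟨β⁻¹ * α, sub_eq_of_eq_add ?_⟩
  rw [mul_left_cancel₀ hβ hfz, map_add, map_smul, hφx, hφy, smul_eq_mul]

/- If additivity fails for `x` and `y`, take `c = f (x + y) - f x`: the surjection
`s ↦ f (x + s • y) - s * c` of the finite field `L` onto itself takes the same value at `0` and at
`1`. -/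
lemma map_add_of_forall_exists_eq [Finite L] (hV : Module.finrank L V = 2)
    (hf : ∀ (r : L) (x : V), f (r • x) = r * f x)
    (hφ : ∀ φ : V →ₗ[L] L, ∃ z, z ≠ 0 ∧ f z = φ z) (x y : V) : f (x + y) = f x + f y := by
  have hf0 : f 0 = 0 := by simpa using hf 0 0
  rcases eq_or_ne y 0 with rfl | hy
  · simp [hf0]
  by_cases hxy : ∃ r : L, r • y = x
  · obtain ⟨r, rfl⟩ := hxy
    have h := hf (r + 1) y
    rw [add_smul, one_smul] at h
    rw [h, hf, add_one_mul]
  · have hli : LinearIndependent L ![y, x] := (LinearIndependent.pair_iff' hy).2 (not_exists.1 hxy)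
    by_contra hne
    have hc : f (x + y) - f x ≠ f y := fun h ↦ hne (by rw [← h, add_sub_cancel])
    have hinj := Finite.injective_iff_surjective.2 (surjective_map_add_smul_sub_mul hV hf hφ hli hc)
    exact zero_ne_one (hinj (a₁ := 0) (a₂ := 1) (by simp))

end Plane

variable {d e : ℕ} {L : Type*} [Field L]

lemma traceLift_pow {E R : Type*} [Field E] [CommRing R] [Algebra E L]
    [Subsingleton (E →+* L)] (hde : PowInverse L d e) (hd : IsDegenerateExponent L d)
    (ψ : AddChar E R) (x : L) : traceLift ψ L (x ^ d) = traceLift ψ L x := by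
  let σ : L →+* L :=
    { powMonoidHom d with
      map_zero' := zero_pow hde.ne_zero
      map_add' := hd }
  let τ : L →ₐ[E] L :=
    { σ with
      commutes' := fun r ↦ RingHom.congr_fun (Subsingleton.elim (σ.comp (algebraMap E L)) _) r }
  exact congrArg ψ (Algebra.trace_eq_of_algEquiv (AlgEquiv.ofBijective τ hde.bijective) x)

variable {F : Type*} [Field F] [Algebra L F]

lemma traceLift_smul_pow_add {R : Type*} [CommRing R] {ψ : AddChar L R}
    (hψ : ∀ x, ψ (x ^ d) = ψ x) (hde : PowInverse L d e) (b x : F) (r : L) :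
    traceLift ψ F ((r • x) ^ d + b * r • x) =
      ψ (r * (Algebra.trace L F (x ^ d) ^ e + Algebra.trace L F (b * x))) := by
  rw [traceLift_apply, map_add, smul_pow, map_smul, mul_smul_comm, map_smul, mul_add,
    AddChar.map_add_eq_mul, AddChar.map_add_eq_mul, ← hψ (r * _ ^ e), mul_pow, hde.symm,
    smul_eq_mul, smul_eq_mul]

variable [Fintype L] [Fintype F]

lemma card_mul_card_filter_trace_eq_zero [DecidableEq L] {R : Type*} [CommRing R] [IsDomain R]
    {ψ : AddChar L R} (hψ : ψ.IsPrimitive) (hψd : ∀ x, ψ (x ^ d) = ψ x) (hde : PowInverse L d e)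
    (b : F) :
    (Fintype.card L : R) * ({x | Algebra.trace L F (x ^ d) ^ e + Algebra.trace L F (b * x) = 0} :
      Finset F).card = Fintype.card F + (Fintype.card L - 1) * binomialSum (traceLift ψ F) d b := by
  have hscale : ∀ r ∈ Finset.univ.erase (0 : L),
      ∑ x : F, traceLift ψ F ((r • x) ^ d + b * r • x) = binomialSum (traceLift ψ F) d b :=
    fun r hr ↦ (MulAction.bijective₀ (Finset.ne_of_mem_erase hr)).sum_comp
      fun x : F ↦ traceLift ψ F (x ^ d + b * x)
  calc (Fintype.card L : R) * ({x | Algebra.trace L F (x ^ d) ^ e + Algebra.trace L F (b * x) = 0} :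
        Finset F).card
      = ∑ r : L, ∑ x : F, traceLift ψ F ((r • x) ^ d + b * r • x) := by
        simp_rw [traceLift_smul_pow_add hψd hde]
        rw [Finset.sum_comm]
        simp_rw [AddChar.sum_mulShift _ hψ]
        simp [← Finset.sum_filter, mul_comm]
    _ = Fintype.card F + (Fintype.card L - 1) * binomialSum (traceLift ψ F) d b := by
        rw [← Finset.add_sum_erase _ _ (Finset.mem_univ (0 : L)), Finset.sum_congr rfl hscale]
        simp [hde.ne_zero, Finset.card_erase_of_mem, Nat.cast_sub Fintype.card_pos]

lemma exists_ne_zero_trace_eq_zero {R : Type*} [CommRing R] [IsDomain R] [CharZero R]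
    {ψ : AddChar L R} (hψ : ψ.IsPrimitive) (hψd : ∀ x, ψ (x ^ d) = ψ x) (hde : PowInverse L d e)
    (hLF : Module.finrank L F = 2) {b : F}
    (hb : binomialSum (traceLift ψ F) d b ≠ -Fintype.card L) :
    ∃ x : F, x ≠ 0 ∧ Algebra.trace L F (x ^ d) ^ e + Algebra.trace L F (b * x) = 0 := by
  classical
  by_contra! hne
  have hL : (Fintype.card L - 1 : R) ≠ 0 :=
    sub_ne_zero.2 (Nat.cast_ne_one.2 Fintype.one_lt_card.ne')
  refine hb (mul_left_cancel₀ hL ?_)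
  have hfilter : ({x | Algebra.trace L F (x ^ d) ^ e + Algebra.trace L F (b * x) = 0} : Finset F) =
      {0} := by
    ext x
    simp only [Finset.mem_filter_univ, Finset.mem_singleton]
    refine ⟨not_imp_not.1 (hne x), ?_⟩
    rintro rfl
    simp [hde.ne_zero, hde.symm.ne_zero]
  have hcount := card_mul_card_filter_trace_eq_zero hψ hψd hde b
  rw [hfilter, Finset.card_singleton, Module.card_eq_pow_finrank (K := L) (V := F), hLF] at hcount
  push_cast at hcount
  linear_combination -hcount

lemma isDegenerateExponent_of_binomialSum_ne {R : Type*} [CommRing R] [IsDomain R] [CharZero R]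
    {ψ : AddChar L R} (hψ : ψ.IsPrimitive) (hψd : ∀ x, ψ (x ^ d) = ψ x) (hde : PowInverse F d e)
    (hd : IsDegenerateExponent L d) (hLF : Module.finrank L F = 2)
    (hW : ∀ b : F, binomialSum (traceLift ψ F) d b ≠ -Fintype.card L) :
    IsDegenerateExponent F d := fun x y ↦ by
  have hdeL : PowInverse L d e := hde.of_ringHom (algebraMap L F)
  have htrace_pow := map_add_of_forall_exists_eq hLF
    (f := fun x : F ↦ Algebra.trace L F (x ^ d) ^ e)
    (fun r x ↦ by rw [smul_pow, map_smul, smul_eq_mul, mul_pow, hdeL])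
    (fun φ ↦ by
      obtain ⟨b, rfl⟩ := ((Algebra.traceForm L F).toDual (traceForm_nondegenerate L F)).surjective φ
      obtain ⟨x, hx, h⟩ := exists_ne_zero_trace_eq_zero hψ hψd hdeL hLF (hW (-b))
      rw [neg_mul, map_neg, add_neg_eq_zero] at h
      exact ⟨x, hx, h⟩)
  have htrace (x y : F) : Algebra.trace L F ((x + y) ^ d) =
      Algebra.trace L F (x ^ d) + Algebra.trace L F (y ^ d) := by
    simpa only [hd _ _, hdeL.symm _] using congrArg (· ^ d) (htrace_pow x y)
  rw [← sub_eq_zero]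
  refine (traceForm_nondegenerate L F).1 _ fun c ↦ ?_
  have hc := htrace (c ^ e * x) (c ^ e * y)
  rw [← mul_add, mul_pow, mul_pow, mul_pow, hde.symm] at hc
  rw [Algebra.traceForm_apply, mul_comm, mul_sub, mul_add, map_sub, map_add, hc, sub_self]

end QuadraticStep

section Tower

variable {p d e k : ℕ} [Fact p.Prime]

lemma isDegenerateExponent_of_quadratic {L F K : Type*} [Field L] [Finite L] [Field F] [Finite F]
    [Field K] [Fintype K] [Algebra L F] [Algebra F K] [Algebra L K] [IsScalarTower L F K]
    [Algebra (ZMod p) L] [Algebra (ZMod p) K] [IsScalarTower (ZMod p) L K] {ψ : AddChar (ZMod p) ℂ}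
    (hψ : ψ ≠ 1) (hde : PowInverse K d e) (hd : IsDegenerateExponent L d)
    (hLF : Module.finrank L F = 2) (hk : Module.finrank (ZMod p) K < 2 * k)
    (hW : ∀ a, ∃ w : ℤ, binomialSum (traceLift ψ K) d a = p ^ k * w) :
    IsDegenerateExponent F d := by
  have := Fintype.ofFinite L
  have := Fintype.ofFinite F
  have hψL : (traceLift ψ L).IsPrimitive := isPrimitive_traceLift hψ
  have hcardL : Fintype.card L = p ^ Module.finrank (ZMod p) L :=
    (FiniteField.pow_finrank_eq_card p L).symm
  have hdegree := Module.finrank_mul_finrank (ZMod p) L K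
  rw [← Module.finrank_mul_finrank L F K, hLF] at hdegree
  refine isDegenerateExponent_of_binomialSum_ne hψL
    (traceLift_pow (hde.of_ringHom (algebraMap L K)) hd ψ) (hde.of_ringHom (algebraMap F K)) hd hLF
    fun b ↦ ?_
  rw [hcardL, Nat.cast_pow]
  refine binomialSum_ne_neg_pow (k := k) hde (isPrimitive_traceLift (ne_one_of_isPrimitive hψL))
    (Fact.out : p.Prime).one_lt Module.finrank_pos.ne' ?_ ?_ ?_ b
  · rw [Module.card_eq_pow_finrank (K := L) (V := F), hLF, hcardL, ← pow_mul, mul_comm]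
  · lia
  · rwa [traceLift_traceLift, traceLift_traceLift]

variable {K : Type*} [Field K] [Fintype K] [Algebra (ZMod p) K]

lemma isDegenerateExponent_galoisField {ψ : AddChar (ZMod p) ℂ} (hψ : ψ ≠ 1)
    (hde : PowInverse K d e) (hk : Module.finrank (ZMod p) K < 2 * k)
    (hW : ∀ a, ∃ w : ℤ, binomialSum (traceLift ψ K) d a = p ^ k * w) :
    ∀ t, 2 ^ t ∣ Module.finrank (ZMod p) K → IsDegenerateExponent (GaloisField p (2 ^ t)) d
  | 0, _ => fun x y ↦ by
    have hself := pow_eq_self_of_binomialSum_int (p := p) hde (isPrimitive_traceLift hψ) fun a ↦ by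
      obtain ⟨w, hw⟩ := hW a
      exact ⟨p ^ k * w, mod_cast hw⟩
    refine (GaloisField.equivZmodP p).injective ?_
    simp only [map_add, map_pow, hself]
  | t + 1, ht => by
    have hpow (t : ℕ) : 2 ^ t ≠ 0 := pow_ne_zero t two_ne_zero
    have := Fintype.ofFinite (GaloisField p (2 ^ t))
    obtain ⟨i⟩ : Nonempty (GaloisField p (2 ^ t) →ₐ[ZMod p] GaloisField p (2 ^ (t + 1))) :=
      FiniteField.nonempty_algHom_of_finrank_dvd <| by
        rw [GaloisField.finrank p (hpow _), GaloisField.finrank p (hpow _)]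
        exact pow_dvd_pow 2 t.le_succ
    obtain ⟨j⟩ : Nonempty (GaloisField p (2 ^ (t + 1)) →ₐ[ZMod p] K) :=
      FiniteField.nonempty_algHom_of_finrank_dvd (by rwa [GaloisField.finrank p (hpow _)])
    let _ := i.toRingHom.toAlgebra
    let _ := j.toRingHom.toAlgebra
    let _ := (j.comp i).toRingHom.toAlgebra
    have : IsScalarTower (GaloisField p (2 ^ t)) (GaloisField p (2 ^ (t + 1))) K :=
      .of_algebraMap_eq' rfl
    have : IsScalarTower (ZMod p) (GaloisField p (2 ^ t)) (GaloisField p (2 ^ (t + 1))) :=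
      .of_algebraMap_eq fun r ↦ (i.commutes r).symm
    have : IsScalarTower (ZMod p) (GaloisField p (2 ^ t)) K :=
      .of_algebraMap_eq fun r ↦ ((j.comp i).commutes r).symm
    have hdegree : Module.finrank (GaloisField p (2 ^ t)) (GaloisField p (2 ^ (t + 1))) = 2 := by
      have h := Module.finrank_mul_finrank (ZMod p) (GaloisField p (2 ^ t))
        (GaloisField p (2 ^ (t + 1)))
      rw [GaloisField.finrank p (hpow _), GaloisField.finrank p (hpow _)] at h
      exact mul_left_cancel₀ (hpow t) (h.trans (pow_succ 2 t))
    exact isDegenerateExponent_of_quadratic hψ hde (isDegenerateExponent_galoisField hψ hde hk hW t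
      ((pow_dvd_pow 2 t.le_succ).trans ht)) hdegree hk hW

end Tower

section WeilSum

variable {p d : ℕ} [Fact p.Prime] {K : Type*} [Field K] [Fintype K] [Algebra (ZMod p) K]

variable (p) in
lemma weilSum_eq_binomialSum (d : ℕ) (a : K) :
    weilSum p K d a = binomialSum (traceLift (ZMod.stdAddChar (N := p)) K) d a := rfl

variable (p) in
lemma stdAddChar_ne_one : ZMod.stdAddChar (N := p) ≠ 1 :=
  ne_one_of_isPrimitive (ZMod.isPrimitive_stdAddChar p)

lemma exponent_ne_zero_of_isThreeValued (h : IsThreeValued p K d) : d ≠ 0 := by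
  rintro rfl
  have hsub : weilValueSet p K 0 ⊆ {0} := by
    rintro _ ⟨a, rfl⟩
    exact binomialSum_exponent_zero (isPrimitive_traceLift (stdAddChar_ne_one p)) a.ne_zero
  have hle := Set.ncard_le_ncard hsub
  rw [h, Set.ncard_singleton] at hle
  norm_num at hle

lemma weilSum_mem_of_weilValueSet_eq {e : ℕ} (hde : PowInverse K d e) {A : ℂ}
    (hA : weilValueSet p K d = {0, A, -A}) (a : K) :
    weilSum p K d a = 0 ∨ weilSum p K d a = A ∨ weilSum p K d a = -A := by
  rcases eq_or_ne a 0 with rfl | ha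
  · exact .inl (binomialSum_zero hde (isPrimitive_traceLift (stdAddChar_ne_one p)))
  · have hmem : weilSum p K d a ∈ weilValueSet p K d := ⟨Units.mk0 a ha, rfl⟩
    rwa [hA] at hmem

lemma sq_rpow_two_rpow_mul_sqrt (p q s : ℕ) :
    ((p : ℝ) ^ ((2 : ℝ) ^ ((s : ℝ) - 1)) * √q) ^ 2 = (p ^ 2 ^ s : ℕ) * q := by
  have hexp : (2 : ℝ) ^ ((s : ℝ) - 1) * (2 : ℕ) = (2 ^ s : ℕ) := by
    rw [Real.rpow_sub_one two_ne_zero, Real.rpow_natCast, Nat.cast_two,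
      div_mul_cancel₀ _ two_ne_zero, Nat.cast_pow, Nat.cast_two]
  rw [mul_pow, Real.sq_sqrt q.cast_nonneg, ← Real.rpow_mul_natCast p.cast_nonneg, hexp,
    Real.rpow_natCast, Nat.cast_pow]

end WeilSum

theorem mainTheorem2 (p : ℕ) [Fact p.Prime] (K : Type*) [Field K] [Fintype K]
    [Algebra (ZMod p) K] (q : ℕ) (hq : Fintype.card K = q)
    (d : ℕ) (hd : Nat.Coprime d (q - 1))
    (s : ℕ) (hs : padicValNat 2 (Module.finrank (ZMod p) K) = s)
    (A : ℂ) (h3 : IsThreeValued p K d) (hA : weilValueSet p K d = {0, A, -A}) :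
    (p : ℝ) ^ ((2 : ℝ) ^ ((s : ℝ) - 1)) * √(q : ℝ) ≤ ‖A‖ := by
  subst hq
  have hψ := stdAddChar_ne_one p
  have hψK := isPrimitive_traceLift (K := K) hψ
  have h2s : 2 ^ s ∣ Module.finrank (ZMod p) K := hs ▸ pow_padicValNat_dvd
  have hF : Module.finrank (ZMod p) (GaloisField p (2 ^ s)) = 2 ^ s :=
    GaloisField.finrank p (pow_ne_zero s two_ne_zero)
  have := Fintype.ofFinite (GaloisField p (2 ^ s))
  obtain ⟨e, hde⟩ := exists_powInverse (exponent_ne_zero_of_isThreeValued h3) hd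
  have hW := weilSum_mem_of_weilValueSet_eq hde hA
  simp only [weilSum_eq_binomialSum] at hW
  obtain ⟨k, hk, hdiv⟩ := exists_binomialSum_eq_pow_mul hde hψK hW Fact.out
    (FiniteField.pow_finrank_eq_card p K).symm
  have hdeg := isDegenerateExponent_galoisField hψ hde hk hdiv s h2s
  obtain ⟨i⟩ : Nonempty (GaloisField p (2 ^ s) →ₐ[ZMod p] K) :=
    FiniteField.nonempty_algHom_of_finrank_dvd (hF.symm ▸ h2s)
  have hcard := card_mul_card_le_norm_sq hde hψK hW i.toRingHom hdeg
  rw [← FiniteField.pow_finrank_eq_card p (GaloisField p (2 ^ s)), hF,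
    ← sq_rpow_two_rpow_mul_sqrt] at hcard
  exact le_of_sq_le_sq hcard (norm_nonneg A)
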